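/- Let $E_0$ and $E_1$ be Banach spaces (both real or both complex) such that $E_1$ is densely and compactly embedded in $E_0$. Let $A$ be the generator of an analytic semigroup $(e^{tA})_{t\ge 0}$ on $E_0$ with domain $E_1$ (in the real case this means that the complexified semigroup is analytic). Let $T>0$, $a\in\mathbb{R}$, and $b\in C^1([0,T],\mathbb{R})$ with $b(0)\neq 0$, and set $$\Phi_T:=a\,e^{TA}+\int_0^T b(t)\,e^{tA}\,\mathrm{d}t .$$ If $\ker(\Phi_T)=\{0\}$, then $\Phi_T$ is an isomorphism from $E_0$ onto $E_1$; that is, $\Phi_T$ maps $E_0$ bijectively onto $E_1$, and $\Phi_T:E_0\to E_1$ and its inverse $E_1\to E_0$ are bounded with respect to the norms of $E_0$ and $E_1$. -/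

import Mathlib

open Set Filter Topology

universe u v

/-- `S` (only its values on `[0, ∞)` matter) is a strongly continuous semigroup of bounded
operators on `E`. -/
structure IsC0Semigroup {𝕜 : Type*} [RCLike 𝕜] {E : Type*} [NormedAddCommGroup E]
    [NormedSpace 𝕜 E] (S : ℝ → E →L[𝕜] E) : Prop where
  zero : S 0 = ContinuousLinearMap.id 𝕜 E
  add : ∀ s t : ℝ, 0 ≤ s → 0 ≤ t → S (s + t) = (S s).comp (S t)
  tendsto_zero : ∀ x : E, Tendsto (fun t : ℝ => S t x) (𝓝[>] 0) (𝓝 x)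

/-- The open sector `{z ≠ 0 : |arg z| < δ}`. -/
def openSector (δ : ℝ) : Set ℂ :=
  {z : ℂ | z ≠ 0 ∧ |Complex.arg z| < δ}

/-- `U` (only its values on `openSector δ ∪ {0}` matter) is an analytic semigroup of angle `δ` on
the complex space `F`. -/
structure IsHolomorphicSemigroup {F : Type*} [NormedAddCommGroup F] [NormedSpace ℂ F]
    (δ : ℝ) (U : ℂ → F →L[ℂ] F) : Prop where
  angle_pos : 0 < δ
  angle_le : δ ≤ Real.pi / 2
  zero : U 0 = ContinuousLinearMap.id ℂ F
  add : ∀ z ∈ openSector δ, ∀ w ∈ openSector δ, U (z + w) = (U z).comp (U w)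
  holomorphic : DifferentiableOn ℂ U (openSector δ)
  tendsto_zero : ∀ δ' : ℝ, 0 < δ' → δ' < δ → ∀ x : F,
    Tendsto (fun z : ℂ => U z x) (𝓝[openSector δ'] 0) (𝓝 x)

/-- `j : E → F` exhibits the complex normed space `F` as the scalar extension of `E` to `ℂ`.
If `𝕜 = ℂ`, then `RCLike.map 𝕜 ℂ` is the identity and `j` is a complex linear isometric
isomorphism (the clause `indep` is then automatic). If `𝕜 = ℝ`, then `(RCLike.I : 𝕜) = 0`, the
map `j` is a real linear isometry, and `F = j(E) ⊕ i j(E)`, i.e. `F` is a complexification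
of `E`. -/
structure IsComplexExtension (𝕜 : Type*) [RCLike 𝕜] {E F : Type*} [NormedAddCommGroup E]
    [NormedSpace 𝕜 E] [NormedAddCommGroup F] [NormedSpace ℂ F] (j : E → F) : Prop where
  map_add : ∀ x y : E, j (x + y) = j x + j y
  map_smul : ∀ (c : 𝕜) (x : E), j (c • x) = RCLike.map 𝕜 ℂ c • j x
  norm_map : ∀ x : E, ‖j x‖ = ‖x‖
  indep : ∀ x y : E, j x + Complex.I • j y = 0 → x + (RCLike.I : 𝕜) • y = 0
  span : ∀ z : F, ∃ x y : E, z = j x + Complex.I • j y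

/-- The semigroup `S` on the real or complex Banach space `E` is analytic: it (its
complexification, if the scalars are real) extends to an analytic semigroup on some sector. -/
def IsAnalyticSemigroup {𝕜 : Type*} [RCLike 𝕜] {E : Type u} [NormedAddCommGroup E]
    [NormedSpace 𝕜 E] (S : ℝ → E →L[𝕜] E) : Prop :=
  IsC0Semigroup S ∧
    ∃ (F : Type u) (_ : NormedAddCommGroup F) (_ : NormedSpace ℂ F) (_ : CompleteSpace F)
      (j : E → F) (δ : ℝ) (U : ℂ → F →L[ℂ] F),
      IsComplexExtension 𝕜 j ∧ IsHolomorphicSemigroup δ U ∧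
        ∀ t : ℝ, 0 ≤ t → ∀ x : E, j (S t x) = U (t : ℂ) (j x)

/-- `A`, regarded through the embedding `i : E₁ → E₀` as an operator in `E₀` with domain `E₁`,
is the infinitesimal generator of `S`: the limit of `(S h x - x) / h` as `h → 0+` exists and equals
`y` exactly when `x` is in the domain and is mapped to `y`. -/
def IsGeneratorWithDomain {𝕜 : Type*} [RCLike 𝕜] {E₀ E₁ : Type*}
    [NormedAddCommGroup E₀] [NormedSpace 𝕜 E₀] [NormedAddCommGroup E₁] [NormedSpace 𝕜 E₁]
    (i : E₁ →L[𝕜] E₀) (A : E₁ →ₗ[𝕜] E₀) (S : ℝ → E₀ →L[𝕜] E₀) : Prop :=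
  ∀ x y : E₀,
    Tendsto (fun h : ℝ => ((h⁻¹ : ℝ) : 𝕜) • (S h x - x)) (𝓝[>] 0) (𝓝 y) ↔
      ∃ u : E₁, i u = x ∧ A u = y

/-- The operator `a S(T) + ∫₀ᵀ b(t) S(t) dt`. -/
noncomputable def timeAverage {𝕜 : Type*} [RCLike 𝕜] {E : Type*} [NormedAddCommGroup E]
    [NormedSpace 𝕜 E] [NormedSpace ℝ E] [IsScalarTower ℝ 𝕜 E]
    (S : ℝ → E →L[𝕜] E) (a : ℝ) (b : ℝ → ℝ) (T : ℝ) : E →L[𝕜] E :=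
  a • S T + ∫ t in (0 : ℝ)..T, b t • S t

/-!
Write `Φ` for the time average. Integration by parts gives
`∫₀ᵀ b S = b(0) ∫₀ᵀ S + ∫₀ᵀ b'(t) (∫ₜᵀ S) dt`, and the generator `A` of `S` maps `∫ᵣᵗ S` to
`S(t) - S(r)`. Hence `Φ` takes values in the domain of `A` and `A Φ = a S'(T) + P - b(0)` with
`P = b(0) S(T) + ∫₀ᵀ b'(t) (S(T) - S(t)) dt`.

The operators `∫₀ᵗ S` factor through the compact embedding of the domain, so they are compact, and
so are their limits `S(t)`, `S'(T)` and `P`. Therefore `(c - A) Φ = b(0) - K` with `K` compact, for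
every real `c`. For `c = ‖S(1)‖` the operator `c - A` is injective: if `A x = c x`, then
`S(1) x = eᶜ x`, and `eᶜ > c = ‖S(1)‖` forces `x = 0`. So if `Φ` is injective, then so is
`b(0) - K`, which is then onto by the Fredholm alternative; hence `Φ` is onto the domain of `A`.
-/

section ComplexExtension

variable {𝕜 : Type*} [RCLike 𝕜] {E F : Type*} [NormedAddCommGroup E] [NormedSpace 𝕜 E]
  [NormedAddCommGroup F] [NormedSpace ℂ F] {j : E → F}

theorem IsComplexExtension.map_sub (hj : IsComplexExtension 𝕜 j) (x y : E) :
    j (x - y) = j x - j y := by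
  rw [eq_sub_iff_add_eq, ← hj.map_add, sub_add_cancel]

theorem IsComplexExtension.opNorm_le_of_intertwines (hj : IsComplexExtension 𝕜 j)
    {P : E →L[𝕜] E} {Q : F →L[ℂ] F} (h : ∀ x, j (P x) = Q (j x)) : ‖P‖ ≤ ‖Q‖ :=
  P.opNorm_le_bound (norm_nonneg Q) fun x => by
    rw [← hj.norm_map, h, ← hj.norm_map x]
    exact Q.le_opNorm _

variable [NormedSpace ℝ E] [IsScalarTower ℝ 𝕜 E]

theorem IsComplexExtension.map_real_smul (hj : IsComplexExtension 𝕜 j) (r : ℝ) (x : E) :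
    j (r • x) = r • j x := by
  rw [RCLike.real_smul_eq_coe_smul (K := 𝕜), hj.map_smul]
  simp [RCLike.map_apply]

-- Intertwined operators satisfy `‖P‖ ≤ ‖Q‖`, so the difference quotients of `P` are Cauchy because
-- those of `Q` are.
theorem IsComplexExtension.differentiableAt_of_intertwines [CompleteSpace E]
    (hj : IsComplexExtension 𝕜 j) {P : ℝ → E →L[𝕜] E} {Q : ℝ → F →L[ℂ] F} {t : ℝ}
    (h : ∀ᶠ s in 𝓝 t, ∀ x, j (P s x) = Q s (j x)) (hQ : DifferentiableAt ℝ Q t) :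
    DifferentiableAt ℝ P t := by
  have hslope : ∀ᶠ s in 𝓝[≠] t, ∀ x, j (slope P t s x) = slope Q t s (j x) := by
    filter_upwards [h.filter_mono nhdsWithin_le_nhds] with s hs x
    simp only [slope_def_module, smul_apply, sub_apply, hj.map_real_smul, hj.map_sub, hs,
      h.self_of_nhds]
  have hcauchy := (hasDerivAt_iff_tendsto_slope.1 hQ.hasDerivAt).cauchy_map
  suffices hP : Cauchy (map (slope P t) (𝓝[≠] t)) by
    obtain ⟨D, hD⟩ := cauchy_map_iff_exists_tendsto.1 hP
    exact (hasDerivAt_iff_tendsto_slope.2 hD).differentiableAt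
  rw [Metric.cauchy_iff] at hcauchy ⊢
  refine ⟨inferInstance, fun ε hε => ?_⟩
  obtain ⟨V, hV, hVε⟩ := hcauchy.2 ε hε
  refine ⟨_, image_mem_map (inter_mem hV hslope), ?_⟩
  rintro _ ⟨r, ⟨hr, hr'⟩, rfl⟩ _ ⟨s, ⟨hs, hs'⟩, rfl⟩
  refine lt_of_le_of_lt ?_ (hVε _ hr _ hs)
  rw [dist_eq_norm, dist_eq_norm]
  refine hj.opNorm_le_of_intertwines fun x => ?_
  rw [sub_apply, sub_apply, hj.map_sub, hr', hs']

end ComplexExtension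

theorem ofReal_mem_openSector {δ t : ℝ} (hδ : 0 < δ) (ht : 0 < t) : (t : ℂ) ∈ openSector δ :=
  ⟨by exact_mod_cast ht.ne', by rwa [Complex.arg_ofReal_of_nonneg ht.le, abs_zero]⟩

theorem IsHolomorphicSemigroup.differentiableAt_ofReal {F : Type*} [NormedAddCommGroup F]
    [NormedSpace ℂ F] {δ : ℝ} {U : ℂ → F →L[ℂ] F} (hU : IsHolomorphicSemigroup δ U) {t : ℝ}
    (ht : 0 < t) : DifferentiableAt ℝ (fun s : ℝ => U s) t := by
  have hsector : ∀ s ∈ Ioi (0 : ℝ), (s : ℂ) ∈ openSector δ :=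
    fun s hs => ofReal_mem_openSector hU.angle_pos hs
  have hdiff : DifferentiableOn ℝ (fun s : ℝ => U s) (Ioi 0) :=
    (hU.holomorphic.restrictScalars ℝ).comp Complex.ofRealCLM.differentiableOn hsector
  exact hdiff.differentiableAt (Ioi_mem_nhds ht)

section CompactOperators

theorem exists_comp_eq_of_forall_mem_range {𝕜 E F G : Type*} [NontriviallyNormedField 𝕜]
    [NormedAddCommGroup E] [NormedSpace 𝕜 E] [CompleteSpace E]
    [NormedAddCommGroup F] [NormedSpace 𝕜 F] [CompleteSpace F]
    [NormedAddCommGroup G] [NormedSpace 𝕜 G] {i : F →L[𝕜] G} (hi : Function.Injective i)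
    {B : E →L[𝕜] G} (hB : ∀ x, B x ∈ LinearMap.range i.toLinearMap) :
    ∃ C : E →L[𝕜] F, i.comp C = B := by
  let g : E →ₗ[𝕜] F := (LinearEquiv.ofInjective i.toLinearMap hi).symm.toLinearMap ∘ₗ
    B.toLinearMap.codRestrict (LinearMap.range i.toLinearMap) hB
  have hg : ∀ x, i (g x) = B x := fun x =>
    congrArg Subtype.val ((LinearEquiv.ofInjective i.toLinearMap hi).apply_symm_apply ⟨B x, hB x⟩)
  refine ⟨ContinuousLinearMap.ofSeqClosedGraph (g := g) fun s x y hs hgs => hi ?_,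
    ContinuousLinearMap.ext hg⟩
  have hBs : Tendsto (fun n => B (s n)) atTop (𝓝 (i y)) := by
    simpa only [Function.comp_def, hg] using (i.continuous.tendsto y).comp hgs
  exact (tendsto_nhds_unique hBs ((B.continuous.tendsto x).comp hs)).trans (hg x).symm

theorem surjective_smul_sub_of_injective {𝕜 E : Type*} [NontriviallyNormedField 𝕜]
    [NormedAddCommGroup E] [NormedSpace 𝕜 E] [CompleteSpace E] {K : E →L[𝕜] E}
    (hK : IsCompactOperator K) {c : 𝕜} (hc : c ≠ 0)
    (hinj : Function.Injective fun x => c • x - K x) :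
    Function.Surjective fun x => c • x - K x := by
  rcases hK.hasEigenvalue_or_mem_resolventSet hc with heig | hres
  · obtain ⟨x, hx⟩ := heig.exists_hasEigenvector
    refine absurd (hinj (?_ : c • x - K x = c • 0 - K 0)) hx.2
    rw [map_zero, smul_zero, sub_zero, sub_eq_zero]
    exact hx.apply_eq_smul.symm
  · have hsurj := (ContinuousLinearMap.isUnit_iff_bijective.1 hres).2
    simpa [Function.Surjective, Algebra.algebraMap_eq_smul_one] using hsurj

theorem bijective_of_comp_eq_smul_sub {𝕜 E F : Type*} [NontriviallyNormedField 𝕜]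
    [NormedAddCommGroup E] [NormedSpace 𝕜 E] [CompleteSpace E] {K : E →L[𝕜] E}
    (hK : IsCompactOperator K) {c : 𝕜} (hc : c ≠ 0) {C : E → F} {L : F → E}
    (hC : Function.Injective C) (hL : Function.Injective L)
    (h : ∀ x, L (C x) = c • x - K x) : Function.Bijective C := by
  have hcomp : L ∘ C = fun x => c • x - K x := funext h
  have hsurj : Function.Surjective (L ∘ C) := by
    rw [hcomp]
    exact surjective_smul_sub_of_injective hK hc (hcomp ▸ hL.comp hC)
  exact ⟨hC, hsurj.of_comp_left hL⟩

variable {𝕜 : Type*} [RCLike 𝕜] {E F : Type*} [NormedAddCommGroup E] [NormedSpace 𝕜 E]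
  [NormedAddCommGroup F] [NormedSpace 𝕜 F] [CompleteSpace F] [NormedSpace ℝ F]
  [IsScalarTower ℝ 𝕜 F] {f : ℝ → E →L[𝕜] F}

theorem isCompactOperator_of_hasDerivWithinAt_Ici {D : E →L[𝕜] F} {t : ℝ}
    (hf : HasDerivWithinAt f D (Ici t) t) (hc : ∀ s ∈ Ici t, IsCompactOperator (f s)) :
    IsCompactOperator D := by
  rw [← hasDerivWithinAt_Ioi_iff_Ici, hasDerivWithinAt_iff_tendsto_slope' self_notMem_Ioi] at hf
  refine isCompactOperator_of_tendsto hf ?_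
  filter_upwards [self_mem_nhdsWithin] with s hs
  exact ((hc s (Ioi_subset_Ici_self hs)).sub (hc t self_mem_Ici)).smul (s - t)⁻¹

theorem isCompactOperator_intervalIntegral {a b : ℝ} (hab : a ≤ b)
    (hf : IntervalIntegrable f MeasureTheory.volume a b)
    (hc : ∀ t ∈ Ioc a b, IsCompactOperator (f t)) :
    IsCompactOperator (∫ t in a..b, f t : E →L[𝕜] F) := by
  rcases hab.eq_or_lt with rfl | hlt
  · simpa using isCompactOperator_zero
  have hconv : Convex ℝ {B : E →L[𝕜] F | IsCompactOperator B} :=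
    fun B hB C hC r s _ _ _ => (hB.smul r).add (hC.smul s)
  have hmem := hconv.set_average_mem (μ := MeasureTheory.volume) (t := Ioc a b) (f := f)
    isClosed_setOfPred_isCompactOperator (by simp [hlt]) (by simp)
    ((MeasureTheory.ae_restrict_iff' measurableSet_Ioc).2 (Eventually.of_forall hc))
    ((intervalIntegrable_iff_integrableOn_Ioc_of_le hab).1 hf)
  have heq : (∫ t in a..b, f t) = (b - a) • ⨍ t in Ioc a b, f t := by
    rw [MeasureTheory.setAverage_eq, intervalIntegral.integral_of_le hab, smul_smul]
    simp [hab, (sub_pos.2 hlt).ne']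
  rw [heq]
  exact IsCompactOperator.smul hmem (b - a)

end CompactOperators

theorem integral_smul_eq_add_integral_derivWithin_smul {G : Type*} [NormedAddCommGroup G]
    [NormedSpace ℝ G] [CompleteSpace G] {f : ℝ → G} {b : ℝ → ℝ} {r T : ℝ} (hrT : r < T)
    (hf : IntervalIntegrable f MeasureTheory.volume r T) (hfc : ContinuousOn f (Ioo r T))
    (hb : ContDiffOn ℝ 1 b (Icc r T)) :
    ∫ t in r..T, b t • f t = b r • (∫ t in r..T, f t) +
      ∫ t in r..T, derivWithin b (Icc r T) t • ∫ s in t..T, f s := by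
  have hb' : ContinuousOn (derivWithin b (Icc r T)) (uIcc r T) := by
    rw [uIcc_of_le hrT.le]
    exact hb.continuousOn_derivWithin (uniqueDiffOn_Icc hrT) le_rfl
  have hprim : ContinuousOn (fun t => ∫ s in T..t, f s) (uIcc r T) :=
    intervalIntegral.continuousOn_primitive_interval' hf right_mem_uIcc
  have hparts := intervalIntegral.integral_smul_deriv_eq_deriv_smul_of_hasDerivAt
    (u := b) (u' := derivWithin b (Icc r T)) (by rw [uIcc_of_le hrT.le]; exact hb.continuousOn)
    hprim (fun t ht => ?_) (fun t ht => ?_) hb'.intervalIntegrable hf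
  · have hsymm : ∀ t, ∫ s in T..t, f s = -∫ s in t..T, f s :=
      fun t => intervalIntegral.integral_symm t T
    rw [hparts, intervalIntegral.integral_same]
    simp [hsymm]
  all_goals rw [min_eq_left hrT.le, max_eq_right hrT.le] at ht
  · exact (hb.differentiableOn one_ne_zero t (Ioo_subset_Icc_self ht)).hasDerivWithinAt.hasDerivAt
      (Icc_mem_nhds ht.1 ht.2)
  · refine intervalIntegral.integral_hasDerivAt_right
      (hf.symm.mono_set (uIcc_subset_uIcc_left ?_))
      (hfc.stronglyMeasurableAtFilter isOpen_Ioo t ht) (hfc.continuousAt (Ioo_mem_nhds ht.1 ht.2))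
    rw [uIcc_of_ge hrT.le]
    exact Ioo_subset_Icc_self ht

/-- `S` is an immediately norm-continuous semigroup: a strongly continuous semigroup which is
continuous in operator norm away from `0`. This is the part of analyticity which makes the
operator-valued integrals of `S` converge and, for a compactly embedded domain, makes the
operators `S t` with `0 < t` compact. -/
structure IsImmediatelyNormContinuous {𝕜 : Type*} [RCLike 𝕜] {E : Type*} [NormedAddCommGroup E]
    [NormedSpace 𝕜 E] (S : ℝ → E →L[𝕜] E) : Prop extends IsC0Semigroup S where
  continuousOn_Ioi : ContinuousOn S (Ioi 0)

section AnalyticSemigroup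

variable {𝕜 : Type*} [RCLike 𝕜] {E : Type u} [NormedAddCommGroup E] [NormedSpace 𝕜 E]
  [CompleteSpace E] [NormedSpace ℝ E] [IsScalarTower ℝ 𝕜 E] {S : ℝ → E →L[𝕜] E}

theorem IsAnalyticSemigroup.differentiableAt (hS : IsAnalyticSemigroup S) {t : ℝ} (ht : 0 < t) :
    DifferentiableAt ℝ S t := by
  obtain ⟨-, F, _, _, _, j, δ, U, hj, hU, hSU⟩ := hS
  refine hj.differentiableAt_of_intertwines ?_ (hU.differentiableAt_ofReal ht)
  filter_upwards [Ioi_mem_nhds ht] with s hs using hSU s (le_of_lt hs)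

theorem IsAnalyticSemigroup.isImmediatelyNormContinuous (hS : IsAnalyticSemigroup S) :
    IsImmediatelyNormContinuous S where
  toIsC0Semigroup := hS.1
  continuousOn_Ioi _ ht := (hS.differentiableAt ht).continuousAt.continuousWithinAt

end AnalyticSemigroup

section Semigroup

variable {𝕜 : Type*} [RCLike 𝕜] {E : Type*} [NormedAddCommGroup E] [NormedSpace 𝕜 E]
  {S : ℝ → E →L[𝕜] E}

theorem IsC0Semigroup.exists_bound_near_zero [CompleteSpace E] (hS : IsC0Semigroup S) :
    ∃ ε > 0, ∃ M, ∀ t ∈ Ioo (0 : ℝ) ε, ‖S t‖ ≤ M := by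
  by_contra! H
  choose t ht hM using fun n : ℕ => H (1 / ((n : ℝ) + 1)) Nat.one_div_pos_of_nat n
  have ht0 : Tendsto t atTop (𝓝[>] 0) := by
    refine tendsto_nhdsWithin_iff.2 ⟨?_, Eventually.of_forall fun n => (ht n).1⟩
    exact squeeze_zero (fun n => (ht n).1.le) (fun n => (ht n).2.le)
      tendsto_one_div_add_atTop_nhds_zero_nat
  obtain ⟨C, hC⟩ := banach_steinhaus (g := fun n => S (t n)) fun x => by
    obtain ⟨C, hC⟩ := ((hS.tendsto_zero x).comp ht0).norm.bddAbove_range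
    exact ⟨C, fun n => hC ⟨n, rfl⟩⟩
  obtain ⟨n, hn⟩ := exists_nat_gt C
  exact absurd (hC n) (not_le.2 (hn.trans (hM n)))

theorem IsImmediatelyNormContinuous.continuousOn_apply (hS : IsImmediatelyNormContinuous S)
    (x : E) : ContinuousOn (fun t => S t x) (Ici 0) := by
  intro t ht
  rcases (mem_Ici.1 ht).eq_or_lt with rfl | hpos
  · rw [← continuousWithinAt_Ioi_iff_Ici]
    simpa [ContinuousWithinAt, hS.zero] using hS.tendsto_zero x
  · exact ((hS.continuousOn_Ioi.continuousAt (Ioi_mem_nhds hpos)).clm_apply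
      continuousAt_const).continuousWithinAt

theorem IsImmediatelyNormContinuous.intervalIntegrable [CompleteSpace E]
    (hS : IsImmediatelyNormContinuous S) {r t : ℝ} (hr : 0 ≤ r) (ht : 0 ≤ t) :
    IntervalIntegrable S MeasureTheory.volume r t := by
  suffices h : ∀ {t : ℝ}, 0 ≤ t → IntervalIntegrable S MeasureTheory.volume 0 t from
    (h hr).symm.trans (h ht)
  intro t ht
  obtain ⟨ε, hε, M, hM⟩ := hS.exists_bound_near_zero
  obtain ⟨N, hN⟩ := (isCompact_Icc (a := ε) (b := t)).exists_bound_of_continuousOn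
    (hS.continuousOn_Ioi.mono fun s hs => hε.trans_le hs.1)
  rw [intervalIntegrable_iff_integrableOn_Ioc_of_le ht]
  refine MeasureTheory.IntegrableOn.of_bound (C := max M N) measure_Ioc_lt_top
    ((hS.continuousOn_Ioi.mono fun s hs => hs.1).aestronglyMeasurable measurableSet_Ioc) ?_
  refine (MeasureTheory.ae_restrict_iff' measurableSet_Ioc).2 (Eventually.of_forall fun s hs => ?_)
  rcases lt_or_ge s ε with hlt | hge
  · exact (hM s ⟨hs.1, hlt⟩).trans (le_max_left _ _)
  · exact (hN s ⟨hge, hs.2⟩).trans (le_max_right _ _)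

variable [NormedSpace ℝ E] [IsScalarTower ℝ 𝕜 E]

theorem IsC0Semigroup.hasDerivWithinAt_apply (hS : IsC0Semigroup S) {x y : E}
    (hx : HasDerivWithinAt (fun h => S h x) y (Ici 0) 0) {t : ℝ} (ht : 0 ≤ t) :
    HasDerivWithinAt (fun s => S s x) (S t y) (Ici t) t := by
  have hshift : HasDerivWithinAt (fun s => S (s - t) x) y (Ici t) t := by
    have hx' : HasDerivWithinAt (fun h => S h x) y (Ici 0) (t - t) := by rwa [sub_self]
    simpa only [Function.comp_def, id, one_smul] using
      hx'.scomp (h := fun s => s - t) t ((hasDerivWithinAt_id t (Ici t)).sub_const t)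
        fun s hs => mem_Ici.2 (sub_nonneg.2 hs)
  have hadd : ∀ s ∈ Ici t, S s x = S t (S (s - t) x) := fun s hs => by
    rw [← ContinuousLinearMap.comp_apply, ← hS.add t (s - t) ht (sub_nonneg.2 hs),
      add_sub_cancel]
  exact (((S t).restrictScalars ℝ).hasFDerivAt.comp_hasDerivWithinAt t hshift).congr hadd
    (hadd t self_mem_Ici)

theorem IsC0Semigroup.hasDerivWithinAt_apply_comp (hS : IsC0Semigroup S) {a t : ℝ}
    (ht : 0 ≤ t) {D : E →L[𝕜] E} (hD : HasDerivWithinAt (fun s => a • S s) D (Ici t) t) (x : E) :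
    HasDerivWithinAt (fun h => S h ((a • S t) x)) (D x) (Ici 0) 0 := by
  have hD' : HasDerivWithinAt (fun s => a • S s) D (Ici t) (0 + t) := by rwa [zero_add]
  have hshift : HasDerivWithinAt (fun h => a • S (h + t)) D (Ici 0) 0 := by
    simpa only [Function.comp_def, id, one_smul] using
      hD'.scomp 0 ((hasDerivWithinAt_id 0 (Ici 0)).add_const t) fun h hh => by
        simpa using mem_Ici.1 hh
  have hadd : ∀ h ∈ Ici (0 : ℝ), S h ((a • S t) x) = (a • S (h + t)) x := fun h hh => by
    simp [hS.add h t hh ht, (S h).map_smul_of_tower]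
  exact (((ContinuousLinearMap.apply 𝕜 E x).restrictScalars ℝ).hasFDerivAt.comp_hasDerivWithinAt 0
    hshift).congr hadd (hadd 0 self_mem_Ici)

theorem IsImmediatelyNormContinuous.apply_eq_exp_smul (hS : IsImmediatelyNormContinuous S)
    {x : E} {c : ℝ}
    (hx : HasDerivWithinAt (fun h => S h x) (c • x) (Ici 0) 0) {t : ℝ} (ht : 0 ≤ t) :
    S t x = Real.exp (c * t) • x := by
  have hexp : ∀ s, HasDerivAt (fun s => Real.exp (c * s) • x) (c • Real.exp (c * s) • x) s := by
    intro s
    simpa [smul_smul, mul_comm] using (((hasDerivAt_id s).const_mul c).exp).smul_const x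
  refine ODE_solution_unique (v := fun _ y => c • y) (K := ‖c‖₊) (a := 0) (b := t)
    (fun _ => lipschitzWith_smul c) ((hS.continuousOn_apply x).mono Icc_subset_Ici_self)
    (fun s hs => ?_) (fun s _ => (hexp s).continuousAt.continuousWithinAt)
    (fun s _ => (hexp s).hasDerivWithinAt) (by simp [hS.zero]) (right_mem_Icc.2 ht)
  simpa only [(S s).map_smul_of_tower] using hS.hasDerivWithinAt_apply hx hs.1

theorem IsImmediatelyNormContinuous.eq_zero_of_hasDerivWithinAt_norm_smul
    (hS : IsImmediatelyNormContinuous S) {x : E}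
    (hx : HasDerivWithinAt (fun h => S h x) (‖S 1‖ • x) (Ici 0) 0) : x = 0 := by
  have hgrowth : Real.exp ‖S 1‖ * ‖x‖ ≤ ‖S 1‖ * ‖x‖ := by
    have hle := (S 1).le_opNorm x
    rwa [hS.apply_eq_exp_smul hx zero_le_one, mul_one, norm_smul,
      Real.norm_of_nonneg (Real.exp_nonneg _)] at hle
  have hexp : ‖S 1‖ < Real.exp ‖S 1‖ := (lt_add_one _).trans_le (Real.add_one_le_exp _)
  by_contra hne
  exact hgrowth.not_gt (mul_lt_mul_of_pos_right hexp (norm_pos_iff.2 hne))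

end Semigroup

section IntegratedSemigroup

variable {𝕜 : Type*} [RCLike 𝕜] {E : Type*} [NormedAddCommGroup E] [NormedSpace 𝕜 E]
  [CompleteSpace E] [NormedSpace ℝ E] [IsScalarTower ℝ 𝕜 E] {S : ℝ → E →L[𝕜] E}

theorem mul_intervalIntegral {f : ℝ → E →L[𝕜] E} {r t : ℝ} (B : E →L[𝕜] E)
    (hf : IntervalIntegrable f MeasureTheory.volume r t) :
    B * ∫ s in r..t, f s = ∫ s in r..t, B * f s :=
  (((ContinuousLinearMap.mul 𝕜 (E →L[𝕜] E)) B).intervalIntegral_comp_comm hf).symm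

theorem intervalIntegral_mul {f : ℝ → E →L[𝕜] E} {r t : ℝ} (B : E →L[𝕜] E)
    (hf : IntervalIntegrable f MeasureTheory.volume r t) :
    (∫ s in r..t, f s) * B = ∫ s in r..t, f s * B :=
  (((ContinuousLinearMap.mul 𝕜 (E →L[𝕜] E)).flip B).intervalIntegral_comp_comm hf).symm

theorem IsImmediatelyNormContinuous.mul_integral (hS : IsImmediatelyNormContinuous S)
    {h r t : ℝ} (hh : 0 ≤ h) (hr : 0 ≤ r) (ht : 0 ≤ t) :
    S h * ∫ s in r..t, S s = ∫ s in (h + r)..(h + t), S s := by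
  rw [mul_intervalIntegral _ (hS.intervalIntegrable hr ht),
    ← intervalIntegral.integral_comp_add_left]
  exact intervalIntegral.integral_congr fun s hs =>
    (hS.add h s hh ((le_min hr ht).trans hs.1)).symm

theorem IsImmediatelyNormContinuous.integral_mul (hS : IsImmediatelyNormContinuous S)
    {h r t : ℝ} (hh : 0 ≤ h) (hr : 0 ≤ r) (ht : 0 ≤ t) :
    (∫ s in r..t, S s) * S h = ∫ s in (r + h)..(t + h), S s := by
  rw [intervalIntegral_mul _ (hS.intervalIntegrable hr ht),
    ← intervalIntegral.integral_comp_add_right]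
  exact intervalIntegral.integral_congr fun s hs =>
    (hS.add s h ((le_min hr ht).trans hs.1) hh).symm

theorem IsImmediatelyNormContinuous.sub_one_mul_integral (hS : IsImmediatelyNormContinuous S)
    {h r t : ℝ} (hh : 0 ≤ h) (hr : 0 ≤ r) (ht : 0 ≤ t) :
    (S h - 1) * ∫ s in r..t, S s = (∫ s in (0 : ℝ)..h, S s) * (S t - S r) := by
  have hint : ∀ {p q : ℝ}, 0 ≤ p → 0 ≤ q → IntervalIntegrable S MeasureTheory.volume p q :=
    hS.intervalIntegrable
  rw [sub_mul, one_mul, mul_sub, hS.mul_integral hh hr ht, hS.integral_mul ht le_rfl hh,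
    hS.integral_mul hr le_rfl hh, zero_add, zero_add,
    intervalIntegral.integral_interval_sub_interval_comm (hint (by positivity) (by positivity))
      (hint hr ht) (hint (by positivity) hr),
    intervalIntegral.integral_symm r, intervalIntegral.integral_symm t]
  abel

theorem IsImmediatelyNormContinuous.hasDerivAt_integral (hS : IsImmediatelyNormContinuous S)
    {t : ℝ} (ht : 0 < t) : HasDerivAt (fun r => ∫ s in (0 : ℝ)..r, S s) (S t) t :=
  intervalIntegral.integral_hasDerivAt_right (hS.intervalIntegrable le_rfl ht.le)
    (hS.continuousOn_Ioi.stronglyMeasurableAtFilter isOpen_Ioi t ht)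
    (hS.continuousOn_Ioi.continuousAt (Ioi_mem_nhds ht))

theorem IsImmediatelyNormContinuous.hasDerivWithinAt_integral_apply
    (hS : IsImmediatelyNormContinuous S) (x : E) :
    HasDerivWithinAt (fun h => (∫ s in (0 : ℝ)..h, S s) x) x (Ici 0) 0 := by
  have hcont : ContinuousOn (fun s => S s x) (Ioi 0) :=
    (hS.continuousOn_apply x).mono Ioi_subset_Ici_self
  have hderiv : HasDerivWithinAt (fun h => ∫ s in (0 : ℝ)..h, S s x) (S 0 x) (Ici 0) 0 :=
    intervalIntegral.integral_hasDerivWithinAt_right (t := Ioi 0) IntervalIntegrable.refl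
      (hcont.stronglyMeasurableAtFilter_nhdsWithin measurableSet_Ioi _)
      ((hS.continuousOn_apply x 0 self_mem_Ici).mono Ioi_subset_Ici_self)
  rw [hS.zero, ContinuousLinearMap.id_apply] at hderiv
  have heq : ∀ h ∈ Ici (0 : ℝ), (∫ s in (0 : ℝ)..h, S s) x = ∫ s in (0 : ℝ)..h, S s x :=
    fun h hh => ContinuousLinearMap.intervalIntegral_apply (hS.intervalIntegrable le_rfl hh) x
  exact hderiv.congr heq (heq 0 self_mem_Ici)

-- The hypothesis is the integrated form of `A B = R`, `A` being the generator; unlike `A B = R`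
-- it is an identity between bounded operators and passes through integrals.
theorem IsImmediatelyNormContinuous.hasDerivWithinAt_apply_of_sub_one_mul_eq
    (hS : IsImmediatelyNormContinuous S) {B R : E →L[𝕜] E}
    (hBR : ∀ h, 0 ≤ h → (S h - 1) * B = (∫ s in (0 : ℝ)..h, S s) * R) (x : E) :
    HasDerivWithinAt (fun h => S h (B x)) (R x) (Ici 0) 0 := by
  have heq : ∀ h ∈ Ici (0 : ℝ), S h (B x) = B x + (∫ s in (0 : ℝ)..h, S s) (R x) :=
    fun h hh => sub_eq_iff_eq_add'.1 (DFunLike.congr_fun (hBR h hh) x)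
  exact ((hS.hasDerivWithinAt_integral_apply (R x)).const_add (B x)).congr heq
    (heq 0 self_mem_Ici)

end IntegratedSemigroup

section TimeAverage

variable {𝕜 : Type*} [RCLike 𝕜] {E : Type*} [NormedAddCommGroup E] [NormedSpace 𝕜 E]
  [NormedSpace ℝ E] [IsScalarTower ℝ 𝕜 E] {S : ℝ → E →L[𝕜] E} {b : ℝ → ℝ} {T : ℝ}

/-- The operator `P = b(0) S(T) + ∫₀ᵀ b'(t) (S(T) - S(t)) dt`, the compact part of
`A ∫₀ᵀ b(t) S(t) dt = P - b(0)`, where `A` is the generator of `S`. The derivative of `b` is taken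
within `[0, T]`, outside of which `b` is arbitrary. -/
noncomputable def generatorCompactPart (S : ℝ → E →L[𝕜] E) (b : ℝ → ℝ) (T : ℝ) : E →L[𝕜] E :=
  b 0 • S T + ∫ t in (0 : ℝ)..T, derivWithin b (Icc 0 T) t • (S T - S t)

variable [CompleteSpace E]

theorem IsImmediatelyNormContinuous.intervalIntegrable_derivWithin_smul_sub
    (hS : IsImmediatelyNormContinuous S) (hT : 0 < T) (hb : ContDiffOn ℝ 1 b (Icc 0 T)) :
    IntervalIntegrable (fun t => derivWithin b (Icc 0 T) t • (S T - S t))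
      MeasureTheory.volume 0 T := by
  refine (intervalIntegrable_const.sub
    (hS.intervalIntegrable le_rfl hT.le)).continuousOn_smul ?_
  rw [uIcc_of_le hT.le]
  exact hb.continuousOn_derivWithin (uniqueDiffOn_Icc hT) le_rfl

theorem IsImmediatelyNormContinuous.sub_one_mul_integral_smul
    (hS : IsImmediatelyNormContinuous S) (hT : 0 < T) (hb : ContDiffOn ℝ 1 b (Icc 0 T))
    {h : ℝ} (hh : 0 ≤ h) :
    (S h - 1) * ∫ t in (0 : ℝ)..T, b t • S t =
      (∫ s in (0 : ℝ)..h, S s) * (generatorCompactPart S b T - b 0 • 1) := by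
  have hb' : ContinuousOn (derivWithin b (Icc 0 T)) (uIcc 0 T) := by
    rw [uIcc_of_le hT.le]
    exact hb.continuousOn_derivWithin (uniqueDiffOn_Icc hT) le_rfl
  have hint := hS.intervalIntegrable le_rfl hT.le
  have htail : ContinuousOn (fun t => ∫ s in t..T, S s) (uIcc 0 T) :=
    (intervalIntegral.continuousOn_primitive_interval' hint right_mem_uIcc).neg.congr
      fun t _ => intervalIntegral.integral_symm T t
  have htail_int : IntervalIntegrable (fun t => derivWithin b (Icc 0 T) t • ∫ s in t..T, S s)
      MeasureTheory.volume 0 T := (hb'.smul htail).intervalIntegrable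
  have hpull : (S h - 1) * (∫ t in (0 : ℝ)..T, derivWithin b (Icc 0 T) t • ∫ s in t..T, S s) =
      (∫ s in (0 : ℝ)..h, S s) *
        ∫ t in (0 : ℝ)..T, derivWithin b (Icc 0 T) t • (S T - S t) := by
    rw [mul_intervalIntegral _ htail_int,
      mul_intervalIntegral _ (hS.intervalIntegrable_derivWithin_smul_sub hT hb)]
    refine intervalIntegral.integral_congr fun t ht => ?_
    rw [uIcc_of_le hT.le] at ht
    simp only [mul_smul_comm, hS.sub_one_mul_integral hh ht.1 hT.le]
  rw [integral_smul_eq_add_integral_derivWithin_smul hT hint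
    (hS.continuousOn_Ioi.mono fun t ht => ht.1) hb, mul_add, hpull, mul_smul_comm,
    hS.sub_one_mul_integral hh le_rfl hT.le, hS.zero, ← mul_smul_comm, ← mul_add,
    generatorCompactPart, smul_sub, sub_add_eq_add_sub]
  rfl

theorem IsImmediatelyNormContinuous.hasDerivWithinAt_timeAverage
    (hS : IsImmediatelyNormContinuous S) (hT : 0 < T) {a : ℝ} (hb : ContDiffOn ℝ 1 b (Icc 0 T))
    {D : E →L[𝕜] E} (hD : HasDerivWithinAt (fun t => a • S t) D (Ici T) T) (x : E) :
    HasDerivWithinAt (fun h => S h (timeAverage S a b T x))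
      ((D + (generatorCompactPart S b T - b 0 • 1)) x) (Ici 0) 0 := by
  have hintegral := hS.hasDerivWithinAt_apply_of_sub_one_mul_eq
    (fun h hh => hS.sub_one_mul_integral_smul hT hb hh) x
  simpa only [timeAverage, add_apply, map_add] using
    (hS.hasDerivWithinAt_apply_comp hT.le hD x).fun_add hintegral

theorem IsImmediatelyNormContinuous.isCompactOperator_generatorCompactPart
    (hS : IsImmediatelyNormContinuous S) (hT : 0 < T) (hb : ContDiffOn ℝ 1 b (Icc 0 T))
    (hc : ∀ t, 0 < t → IsCompactOperator (S t)) :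
    IsCompactOperator (generatorCompactPart S b T) :=
  ((hc T hT).smul (b 0)).add <| isCompactOperator_intervalIntegral hT.le
    (hS.intervalIntegrable_derivWithin_smul_sub hT hb)
    fun t ht => ((hc T hT).sub (hc t ht.1)).smul _

end TimeAverage

section Domain

variable {𝕜 : Type*} [RCLike 𝕜] {E₀ : Type*} [NormedAddCommGroup E₀] [NormedSpace 𝕜 E₀]
  [NormedSpace ℝ E₀] [IsScalarTower ℝ 𝕜 E₀]
  {E₁ : Type*} [NormedAddCommGroup E₁] [NormedSpace 𝕜 E₁] {i : E₁ →L[𝕜] E₀}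
  {A : E₁ →ₗ[𝕜] E₀} {S : ℝ → E₀ →L[𝕜] E₀}

theorem IsGeneratorWithDomain.hasDerivWithinAt_iff (hA : IsGeneratorWithDomain i A S)
    (hS : IsC0Semigroup S) {x y : E₀} :
    HasDerivWithinAt (fun h => S h x) y (Ici 0) 0 ↔ ∃ u : E₁, i u = x ∧ A u = y := by
  have hslope : slope (fun h => S h x) 0 = fun h => ((h⁻¹ : ℝ) : 𝕜) • (S h x - x) := by
    funext h
    rw [slope_def_module, sub_zero, hS.zero, ContinuousLinearMap.id_apply,
      RCLike.real_smul_eq_coe_smul (K := 𝕜)]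
  rw [← hA x y, ← hasDerivWithinAt_Ioi_iff_Ici,
    hasDerivWithinAt_iff_tendsto_slope' self_notMem_Ioi, hslope]

theorem IsGeneratorWithDomain.injective_norm_smul_sub (hA : IsGeneratorWithDomain i A S)
    (hS : IsImmediatelyNormContinuous S) (hi : Function.Injective i) :
    Function.Injective fun u => ‖S 1‖ • i u - A u := by
  intro u v huv
  have heig : A (u - v) = ‖S 1‖ • i (u - v) := by
    rw [map_sub, map_sub, smul_sub]
    exact (sub_eq_sub_iff_sub_eq_sub.1 huv).symm
  have hzero : i (u - v) = 0 := hS.eq_zero_of_hasDerivWithinAt_norm_smul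
    ((hA.hasDerivWithinAt_iff hS.toIsC0Semigroup).2 ⟨u - v, rfl, heig⟩)
  exact hi (sub_eq_zero.1 (by rw [← map_sub, hzero]))

variable [CompleteSpace E₀] [CompleteSpace E₁]

theorem IsGeneratorWithDomain.exists_comp_eq (hA : IsGeneratorWithDomain i A S)
    (hS : IsC0Semigroup S) (hi : Function.Injective i) {B R : E₀ →L[𝕜] E₀}
    (hBR : ∀ x, HasDerivWithinAt (fun h => S h (B x)) (R x) (Ici 0) 0) :
    ∃ C : E₀ →L[𝕜] E₁, i.comp C = B ∧ ∀ x, A (C x) = R x := by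
  have hdom : ∀ x, ∃ u, i u = B x ∧ A u = R x := fun x => (hA.hasDerivWithinAt_iff hS).1 (hBR x)
  obtain ⟨C, hC⟩ := exists_comp_eq_of_forall_mem_range hi
    fun x => (hdom x).imp fun _ hu => hu.1
  refine ⟨C, hC, fun x => ?_⟩
  obtain ⟨u, hu, hAu⟩ := hdom x
  have hCu : C x = u := hi ((DFunLike.congr_fun hC x).trans hu.symm)
  rw [hCu, hAu]

theorem IsImmediatelyNormContinuous.isCompactOperator_integral
    (hS : IsImmediatelyNormContinuous S) (hA : IsGeneratorWithDomain i A S)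
    (hi : Function.Injective i) (hi_compact : IsCompactOperator i) {t : ℝ} (ht : 0 ≤ t) :
    IsCompactOperator (∫ s in (0 : ℝ)..t, S s : E₀ →L[𝕜] E₀) := by
  obtain ⟨C, hC, -⟩ := hA.exists_comp_eq hS.toIsC0Semigroup hi
    (hS.hasDerivWithinAt_apply_of_sub_one_mul_eq
      fun h hh => hS.sub_one_mul_integral hh le_rfl ht)
  rw [← hC]
  exact hi_compact.comp_clm C

theorem IsImmediatelyNormContinuous.isCompactOperator (hS : IsImmediatelyNormContinuous S)
    (hA : IsGeneratorWithDomain i A S) (hi : Function.Injective i)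
    (hi_compact : IsCompactOperator i) {t : ℝ} (ht : 0 < t) : IsCompactOperator (S t) :=
  isCompactOperator_of_hasDerivWithinAt_Ici (hS.hasDerivAt_integral ht).hasDerivWithinAt
    fun _ hs => hS.isCompactOperator_integral hA hi hi_compact (ht.le.trans hs)

end Domain

theorem proposition1_general {𝕜 : Type*} [RCLike 𝕜]
    {E₀ : Type*} [NormedAddCommGroup E₀] [NormedSpace 𝕜 E₀] [CompleteSpace E₀]
    [NormedSpace ℝ E₀] [IsScalarTower ℝ 𝕜 E₀]
    {E₁ : Type*} [NormedAddCommGroup E₁] [NormedSpace 𝕜 E₁] [CompleteSpace E₁]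
    {i : E₁ →L[𝕜] E₀} (hi_inj : Function.Injective i) (hi_compact : IsCompactOperator i)
    {A : E₁ →ₗ[𝕜] E₀} {S : ℝ → E₀ →L[𝕜] E₀} (hS : IsImmediatelyNormContinuous S)
    (hA : IsGeneratorWithDomain i A S) {T : ℝ} (hT : 0 < T) {a : ℝ}
    (ha : DifferentiableWithinAt ℝ (fun t => a • S t) (Ici T) T)
    {b : ℝ → ℝ} (hb : ContDiffOn ℝ 1 b (Icc 0 T)) (hb0 : b 0 ≠ 0)
    (hker : LinearMap.ker (timeAverage S a b T).toLinearMap = ⊥) :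
    ∃ Φ : E₀ ≃L[𝕜] E₁, i.comp (Φ : E₀ →L[𝕜] E₁) = timeAverage S a b T := by
  set D := derivWithin (fun t => a • S t) (Ici T) T
  have hc : ∀ t, 0 < t → IsCompactOperator (S t) :=
    fun _ => hS.isCompactOperator hA hi_inj hi_compact
  have hD : IsCompactOperator D := isCompactOperator_of_hasDerivWithinAt_Ici ha.hasDerivWithinAt
    fun t ht => (hc t (hT.trans_le ht)).smul a
  obtain ⟨C, hC, hAC⟩ := hA.exists_comp_eq hS.toIsC0Semigroup hi_inj
    (hS.hasDerivWithinAt_timeAverage hT hb ha.hasDerivWithinAt)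
  have hK : IsCompactOperator (D + generatorCompactPart S b T - ‖S 1‖ • i.comp C) :=
    (hD.add (hS.isCompactOperator_generatorCompactPart hT hb hc)).sub
      ((hi_compact.comp_clm C).smul ‖S 1‖)
  have hC_inj : Function.Injective C := by
    rw [← hC] at hker
    exact Function.Injective.of_comp (f := i) (LinearMap.ker_eq_bot.1 hker)
  have hLC : ∀ x, ‖S 1‖ • i (C x) - A (C x) =
      ((b 0 : ℝ) : 𝕜) • x - (D + generatorCompactPart S b T - ‖S 1‖ • i.comp C) x := fun x => by
    rw [hAC, ← RCLike.real_smul_eq_coe_smul]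
    simp only [add_apply, sub_apply, smul_apply, ContinuousLinearMap.comp_apply,
      one_apply_eq_self]
    abel
  have hC_bij := bijective_of_comp_eq_smul_sub hK (RCLike.ofReal_ne_zero.2 hb0) hC_inj
    (hA.injective_norm_smul_sub hS hi_inj) hLC
  refine ⟨ContinuousLinearEquiv.ofBijective C (LinearMap.ker_eq_bot.2 hC_bij.1)
    (LinearMap.range_eq_top.2 hC_bij.2), ?_⟩
  rw [ContinuousLinearEquiv.coe_ofBijective, hC]

theorem proposition1 {𝕜 : Type*} [RCLike 𝕜]
    {E₀ : Type u} [NormedAddCommGroup E₀] [NormedSpace 𝕜 E₀] [CompleteSpace E₀]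
    [NormedSpace ℝ E₀] [IsScalarTower ℝ 𝕜 E₀]
    {E₁ : Type v} [NormedAddCommGroup E₁] [NormedSpace 𝕜 E₁] [CompleteSpace E₁]
    (i : E₁ →L[𝕜] E₀) (hi_inj : Function.Injective i) (hi_dense : DenseRange i)
    (hi_compact : IsCompactOperator i)
    (A : E₁ →ₗ[𝕜] E₀) (S : ℝ → E₀ →L[𝕜] E₀)
    (hS : IsAnalyticSemigroup S) (hA : IsGeneratorWithDomain i A S)
    (T : ℝ) (hT : 0 < T) (a : ℝ) (b : ℝ → ℝ) (hb : ContDiffOn ℝ 1 b (Set.Icc 0 T))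
    (hb0 : b 0 ≠ 0)
    (hker : LinearMap.ker (timeAverage S a b T).toLinearMap = ⊥) :
    ∃ Φ : E₀ ≃L[𝕜] E₁, i.comp (Φ : E₀ →L[𝕜] E₁) = timeAverage S a b T :=
  proposition1_general hi_inj hi_compact hS.isImmediatelyNormContinuous hA hT
    ((hS.differentiableAt hT).const_smul a).differentiableWithinAt hb hb0 hker
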